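/- Let $n\ge 1$ and let $A=(a_{ij})$ be an indecomposable symmetrizable generalized $n\times n$ Cartan matrix, that is, an integral matrix with $a_{ii}=2$ for all $i$ and $a_{ij}\le 0$ for $i\neq j$, which is not conjugate under a permutation matrix to a block-diagonal matrix $\begin{pmatrix}A_1&0\\0&A_2\end{pmatrix}$ with square blocks $A_1$, $A_2$ of positive size, and for which there exist integers $d_i>0$ with $d_ia_{ij}=d_ja_{ji}$ for all $i,j$. Let $e_1,\dots,e_n$ be the standard basis of $\mathbb Z^n$, let $\sigma_1,\dots,\sigma_n\in GL(\mathbb Z^n)$ be the simple reflections, given by $\sigma_i(e_j)=e_j-a_{ij}e_i$ for all $i,j$, and let the Weyl group $\mathcal W(A)$ be the subgroup of $GL(\mathbb Z^n)$ generated by $\sigma_1,\dots,\sigma_n$. For $w\in\mathcal W(A)$ let $\ell(w)$ be the smallest integer $l\ge 0$ such that $w$ is a product of $l$ simple reflections. Let $c=\sigma_{v_n}\cdots\sigma_{v_1}$, where $v_1,\dots,v_n$ is any permutation of $1,\dots,n$, be a Coxeter element of $\mathcal W(A)$. Then $\mathcal W(A)$ is infinite if and only if $\ell(c^m)=|m|\,n$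 for all $m\in\mathbb Z$ (that is, all powers of $c$ are reduced words). -/

import Mathlib

noncomputable section

namespace GenCartan

variable {n : ℕ}

/-- `A` is decomposable if a simultaneous permutation of its rows and columns brings it to the
form `diag(A₁, A₂)`, with both square blocks of positive size. -/
def IsDecomposable (A : Matrix (Fin n) (Fin n) ℤ) : Prop :=
  ∃ (p q : ℕ) (e : Fin n ≃ Fin p ⊕ Fin q)
    (A₁ : Matrix (Fin p) (Fin p) ℤ) (A₂ : Matrix (Fin q) (Fin q) ℤ),
    0 < p ∧ 0 < q ∧ Matrix.reindex e e A = Matrix.fromBlocks A₁ 0 0 A₂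

/-- Indecomposable symmetrizable generalized Cartan matrices. The usual requirement that
`A i j = 0` if and only if `A j i = 0` follows from `symmetrizable`. -/
structure IsIndecomposableSymmetrizable (A : Matrix (Fin n) (Fin n) ℤ) : Prop where
  diag : ∀ i, A i i = 2
  nonpos : ∀ i j, i ≠ j → A i j ≤ 0
  indecomposable : ¬ IsDecomposable A
  symmetrizable : ∃ d : Fin n → ℤ, (∀ i, 0 < d i) ∧ ∀ i j, d i * A i j = d j * A j i

/-- The linear form on the root lattice `ℤⁿ` that sends `e_j` to `A i j`. -/
def coroot (A : Matrix (Fin n) (Fin n) ℤ) (i : Fin n) : Module.Dual ℤ (Fin n → ℤ) :=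
  LinearMap.proj i ∘ₗ A.mulVecLin

theorem coroot_single (A : Matrix (Fin n) (Fin n) ℤ) (i j : Fin n) :
    coroot A i (Pi.single j 1) = A i j := by
  simp [coroot]

variable {A : Matrix (Fin n) (Fin n) ℤ}

/-- The simple reflection `σ_i` of `ℤⁿ`, as an element of `GL(ℤⁿ)`. -/
def reflection (h : ∀ i, A i i = 2) (i : Fin n) : (Fin n → ℤ) ≃ₗ[ℤ] (Fin n → ℤ) :=
  Module.reflection (x := Pi.single i 1) (f := coroot A i) ((coroot_single A i i).trans (h i))

theorem reflection_single (h : ∀ i, A i i = 2) (i j : Fin n) :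
    reflection h i (Pi.single j 1) = Pi.single j 1 - A i j • Pi.single i 1 := by
  simp only [reflection, Module.reflection_apply, coroot_single]

/-- The Weyl group: the subgroup of `GL(ℤⁿ)` generated by the simple reflections. -/
def weylGroup (h : ∀ i, A i i = 2) : Subgroup ((Fin n → ℤ) ≃ₗ[ℤ] (Fin n → ℤ)) :=
  Subgroup.closure (Set.range (reflection h))

/-- The simple reflection `σ_i` as an element of the Weyl group. -/
def simple (h : ∀ i, A i i = 2) (i : Fin n) : weylGroup h :=
  ⟨reflection h i, Subgroup.subset_closure ⟨i, rfl⟩⟩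

/-- The length of `w`: the least `l` such that `w` is a product of `l` simple reflections. -/
def length (h : ∀ i, A i i = 2) (w : weylGroup h) : ℕ :=
  sInf {l | ∃ ω : List (Fin n), ω.length = l ∧ (ω.map (simple h)).prod = w}

theorem simple_mul_self (h : ∀ i, A i i = 2) (i : Fin n) : simple h i * simple h i = 1 := by
  apply Subtype.ext
  exact LinearEquiv.ext (Module.involutive_reflection ((coroot_single A i i).trans (h i)))

/-- Every element of the Weyl group is a product of simple reflections, so that the set in the
definition of `length` is nonempty. -/
theorem exists_word (h : ∀ i, A i i = 2) (w : weylGroup h) :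
    ∃ ω : List (Fin n), (ω.map (simple h)).prod = w := by
  obtain ⟨w, hw⟩ := w
  induction hw using Subgroup.closure_induction with
  | mem x hx => obtain ⟨i, rfl⟩ := hx; exact ⟨[i], by simp [simple]⟩
  | one => exact ⟨[], rfl⟩
  | mul x y hx hy ihx ihy =>
    obtain ⟨a, ha⟩ := ihx
    obtain ⟨b, hb⟩ := ihy
    exact ⟨a ++ b, by rw [List.map_append, List.prod_append, ha, hb]; rfl⟩
  | inv x hx ih =>
    obtain ⟨a, ha⟩ := ih
    refine ⟨a.reverse, ?_⟩
    have hs : (fun i => (simple h i)⁻¹) = simple h :=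
      funext fun i => inv_eq_of_mul_eq_one_left (simple_mul_self h i)
    have := congrArg (·⁻¹) ha
    rw [List.prod_inv_reverse, List.map_map] at this
    rw [List.map_reverse, ← hs]
    exact this

/-- The Coxeter element `σ_{v_n} ⋯ σ_{v_1}` given by a permutation `v_1, …, v_n` of the
indices. -/
def coxeterElement (h : ∀ i, A i i = 2) (v : Equiv.Perm (Fin n)) : weylGroup h :=
  (List.ofFn fun k => simple h (v k)).reverse.prod

end GenCartan

end

/-!
# Powers of a Coxeter element in an infinite Weyl group are reduced

If all powers of `c` have the length `|m| n`, then they are distinct and the group is infinite. For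
the other direction it is enough to treat `c ^ m` with `m ≥ 0`, which is a prefix of the periodic
word `a 0, a 1, …` that repeats an ordering of the indices. Let `w_k` be the product of the first
`k` reflections of this word and `β_k = w_k e_{a k}`. By the standard dictionary between lengths and
signs of roots (`apply_single_nonneg`, proved by reduction to rank two), the word is reduced as soon
as all the roots `β_k` are positive. The first `β_k` that is not positive is the negative of an
earlier one, `β_k = -β_l` with `l < k` (`exists_prefixProd_apply_eq_neg`), and this has to be
excluded.

When the group is infinite, the invariant form `B` is not positive definite, since an isometry group
of a positive definite form on a lattice is finite. A nonnegative eigenvector of the matrix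
`(d i * A i j)` for its least eigenvalue, as in Perron–Frobenius, is then a real vector `δ` with all
coordinates positive and `B(e_i, δ) ≤ 0` for all `i` (`exists_pos_antidominant`; indecomposability
enters here).

The Euler form `E` of the ordering is a bilinear form with symmetrization `B`. A simple reflection of
the first index carries `E` to the Euler form of the rotated ordering
(`eulerForm_realReflection`), and `E(e_i, y) = d i * y i` for the first index `i`
(`eulerForm_single_head`). Hence `E(β_l, δ) = d i * (w_l⁻¹ δ) i` with `i = a l`. As long as the earlier
roots are positive, every step from `w_j⁻¹ δ` to `w_{j+1}⁻¹ δ` adds `-B(β_j, δ) / d i ≥ 0` to the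
coordinate of index `i = a j`, so `w_l⁻¹ δ ≥ δ > 0` and `E(β_l, δ) > 0`. Both `E(β_l, δ)` and
`E(β_k, δ)` are therefore positive, and `β_k = -β_l` is impossible
(`prefixProd_apply_single_nonneg`).
-/

noncomputable section

namespace GenCartan

variable {n : ℕ} {A : Matrix (Fin n) (Fin n) ℤ}

open Matrix
open CoxeterSystem (alternatingWord alternatingWord_succ alternatingWord_succ'
  length_alternatingWord)

/-! ### The length function -/

theorem reflection_eq (h : ∀ i, A i i = 2) (i : Fin n) (x : Fin n → ℤ) :
    reflection h i x = x - coroot A i x • Pi.single i 1 := by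
  simp only [reflection, Module.reflection_apply]

theorem length_prod_le (h : ∀ i, A i i = 2) (ω : List (Fin n)) :
    length h (ω.map (simple h)).prod ≤ ω.length :=
  Nat.sInf_le ⟨ω, rfl, rfl⟩

theorem exists_reduced_word (h : ∀ i, A i i = 2) (w : weylGroup h) :
    ∃ ω : List (Fin n), ω.length = length h w ∧ (ω.map (simple h)).prod = w := by
  obtain ⟨ω, hω⟩ := exists_word h w
  exact Nat.sInf_mem (s := {l | ∃ ω : List (Fin n), ω.length = l ∧ (ω.map (simple h)).prod = w})
    ⟨ω.length, ω, rfl, hω⟩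

theorem length_mul_prod_le (h : ∀ i, A i i = 2) (w : weylGroup h) (ω : List (Fin n)) :
    length h (w * (ω.map (simple h)).prod) ≤ length h w + ω.length := by
  obtain ⟨η, hη, rfl⟩ := exists_reduced_word h w
  rw [← hη, ← List.length_append, ← List.prod_append, ← List.map_append]
  exact length_prod_le h _

theorem length_mul_simple_le (h : ∀ i, A i i = 2) (w : weylGroup h) (i : Fin n) :
    length h (w * simple h i) ≤ length h w + 1 := by
  simpa using length_mul_prod_le h w [i]

theorem mul_simple_mul_simple (h : ∀ i, A i i = 2) (w : weylGroup h) (i : Fin n) :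
    w * simple h i * simple h i = w := by
  rw [mul_assoc, simple_mul_self, mul_one]

theorem length_le_mul_simple (h : ∀ i, A i i = 2) (w : weylGroup h) (i : Fin n) :
    length h w ≤ length h (w * simple h i) + 1 := by
  simpa [mul_simple_mul_simple] using length_mul_simple_le h (w * simple h i) i

theorem simple_inv (h : ∀ i, A i i = 2) (i : Fin n) : (simple h i)⁻¹ = simple h i :=
  inv_eq_of_mul_eq_one_left (simple_mul_self h i)

theorem prod_reverse_map_simple (h : ∀ i, A i i = 2) (ω : List (Fin n)) :
    (ω.reverse.map (simple h)).prod = (ω.map (simple h)).prod⁻¹ := by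
  induction ω with
  | nil => simp
  | cons i ω ih => simp [ih, simple_inv, -List.map_reverse]

theorem length_inv_le (h : ∀ i, A i i = 2) (w : weylGroup h) :
    length h w⁻¹ ≤ length h w := by
  obtain ⟨ω, hω, rfl⟩ := exists_reduced_word h w
  rw [← hω, ← prod_reverse_map_simple, ← List.length_reverse]
  exact length_prod_le h _

theorem length_inv (h : ∀ i, A i i = 2) (w : weylGroup h) : length h w⁻¹ = length h w :=
  le_antisymm (length_inv_le h w) (by simpa using length_inv_le h w⁻¹)

/-! ### Rank two -/

/-- Going down from `w` by right multiplications by `t, s, t, …` as long as the length drops, one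
ends at the minimal element `v` of the coset of `w` modulo the dihedral subgroup of `s` and `t`. -/
theorem exists_eq_mul_alternatingWord (h : ∀ i, A i i = 2) (w : weylGroup h) (s t : Fin n)
    (hw : length h w ≤ length h (w * simple h s)) :
    ∃ (v : weylGroup h) (k : ℕ), w = v * ((alternatingWord s t k).map (simple h)).prod ∧
      length h w = length h v + k ∧ length h v ≤ length h (v * simple h s) ∧
      length h v ≤ length h (v * simple h t) := by
  induction hl : length h w using Nat.strong_induction_on generalizing w s t with
  | _ l ih =>
    by_cases hwt : length h w ≤ length h (w * simple h t)
    · exact ⟨w, 0, by simp [alternatingWord], by omega, hw, hwt⟩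
    · have h1 := length_le_mul_simple h w t
      obtain ⟨v, k, e, hk, hvt, hvs⟩ := ih (length h (w * simple h t)) (by omega)
        (w * simple h t) t s (by rw [mul_simple_mul_simple]; omega) rfl
      refine ⟨v, k + 1, ?_, by omega, hvs, hvt⟩
      rw [alternatingWord_succ, List.concat_eq_append, List.map_append, List.prod_append,
        ← mul_assoc, ← e]
      simp [mul_simple_mul_simple]

theorem exists_alternatingWord_add {B : Type*} (s t : B) (m k : ℕ) :
    ∃ ω : List B, ω.length = k ∧ alternatingWord s t (m + k) = ω ++ alternatingWord s t m := by
  induction k with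
  | zero => exact ⟨[], rfl, rfl⟩
  | succ k ih =>
    obtain ⟨ω, hω, e⟩ := ih
    exact ⟨_ :: ω, by simp [hω], by rw [← add_assoc, alternatingWord_succ', e]; rfl⟩

theorem mul_val_apply (h : ∀ i, A i i = 2) (v w : weylGroup h) (x : Fin n → ℤ) :
    (v * w).1 x = v.1 (w.1 x) := rfl

theorem simple_val (h : ∀ i, A i i = 2) (i : Fin n) : (simple h i).1 = reflection h i := rfl

/-- The coefficients of `e_s` and `e_t` in the image of `e_s` under the alternating word of
length `k` in the simple reflections of `s` and `t` that ends in `t`, where `p = A s t` and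
`q = A t s`. -/
def dihedralCoeff (p q : ℤ) : ℕ → ℤ × ℤ
  | 0 => (1, 0)
  | k + 1 =>
    if k % 2 = 0 then ((dihedralCoeff p q k).1, -q * (dihedralCoeff p q k).1 -
      (dihedralCoeff p q k).2)
    else (-p * (dihedralCoeff p q k).2 - (dihedralCoeff p q k).1, (dihedralCoeff p q k).2)

theorem alternatingWord_apply (h : ∀ i, A i i = 2) (s t : Fin n) (k : ℕ) :
    (((alternatingWord s t k).map (simple h)).prod : weylGroup h).1 (Pi.single s 1) =
      (dihedralCoeff (A s t) (A t s) k).1 • Pi.single s 1 +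
        (dihedralCoeff (A s t) (A t s) k).2 • Pi.single t 1 := by
  induction k with
  | zero => simp [alternatingWord, dihedralCoeff]
  | succ k ih =>
    rw [alternatingWord_succ', List.map_cons, List.prod_cons, mul_val_apply, ih, simple_val,
      map_add, map_smul, map_smul, reflection_single, reflection_single]
    by_cases hk : Even k
    · simp only [dihedralCoeff, hk, Nat.even_iff.1 hk, if_true, h]
      module
    · simp only [dihedralCoeff, hk, mt Nat.even_iff.2 hk, if_false, h]
      module

/-- The infinite dihedral case: the inequality `2x ≥ -p y` or `2y ≥ -q x`, alternating with the
parity of `k`, keeps both coefficients from changing sign. -/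
theorem dihedralCoeff_of_four_le {p q : ℤ} (hp : p ≤ 0) (hq : q ≤ 0) (h4 : 4 ≤ p * q) (k : ℕ) :
    0 ≤ (dihedralCoeff p q k).1 ∧ 0 ≤ (dihedralCoeff p q k).2 ∧
      if k % 2 = 0 then 0 ≤ 2 * (dihedralCoeff p q k).1 + p * (dihedralCoeff p q k).2
      else 0 ≤ 2 * (dihedralCoeff p q k).2 + q * (dihedralCoeff p q k).1 := by
  induction k with
  | zero => simp [dihedralCoeff]
  | succ k ih =>
    obtain ⟨hx, hy, hxy⟩ := ih
    by_cases hk : k % 2 = 0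
    · have hk' : ¬ (k + 1) % 2 = 0 := by omega
      simp only [dihedralCoeff, hk, hk', if_true, if_false] at hxy ⊢
      generalize (dihedralCoeff p q k).1 = x at *
      generalize (dihedralCoeff p q k).2 = y at *
      have h2 : 2 * y ≤ -q * x := by nlinarith
      exact ⟨hx, by linarith, by linarith⟩
    · have hk' : (k + 1) % 2 = 0 := by omega
      simp only [dihedralCoeff, hk, hk', if_true, if_false] at hxy ⊢
      generalize (dihedralCoeff p q k).1 = x at *
      generalize (dihedralCoeff p q k).2 = y at *
      have h2 : 2 * x ≤ -p * y := by nlinarith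
      exact ⟨by linarith, hy, by linarith⟩

/-- The braid relations of length `2`, `3`, `4` and `6`. -/
theorem alternatingWord_braid (h : ∀ i, A i i = 2) (s t : Fin n) {m : ℕ}
    (hm : (A s t = 0 ∧ A t s = 0 ∧ m = 2) ∨ (A s t = -1 ∧ A t s = -1 ∧ m = 3) ∨
      (A s t * A t s = 2 ∧ m = 4) ∨ (A s t * A t s = 3 ∧ m = 6)) :
    ((alternatingWord s t m).map (simple h)).prod =
      ((alternatingWord t s m).map (simple h)).prod := by
  apply Subtype.ext
  refine LinearEquiv.ext fun x => ?_
  rcases hm with ⟨p, q, rfl⟩ | ⟨p, q, rfl⟩ | ⟨pq, rfl⟩ | ⟨pq, rfl⟩ <;>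
    simp only [alternatingWord, List.concat_eq_append, List.nil_append, List.cons_append,
      List.map_cons, List.map_nil, List.prod_cons, List.prod_nil, mul_one, mul_val_apply,
      simple_val, reflection_eq, map_sub, map_smul, coroot_single, h] <;>
    generalize coroot A s x = a <;> generalize coroot A t x = b
  · rw [p, q]; module
  · rw [p, q]; module
  · generalize A s t = p at *
    generalize A t s = q at *
    match_scalars
    · ring
    · linear_combination (b * p) * pq
    · linear_combination -(a * q) * pq
  · generalize A s t = p at *
    generalize A t s = q at *
    match_scalars
    · ring
    · linear_combination (b * p * (p * q - 1)) * pq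
    · linear_combination -(a * q * (p * q - 1)) * pq

/-- The rank-two alternative: an alternating word ending in `t` keeps `e_s` nonnegative unless it
is long enough to contain a braid relation. -/
theorem dihedralCoeff_nonneg_or_braid (h : ∀ i, A i i = 2) (s t : Fin n)
    (hst : A s t ≤ 0) (hts : A t s ≤ 0) (h0 : A s t = 0 ↔ A t s = 0) (k : ℕ) :
    (0 ≤ (dihedralCoeff (A s t) (A t s) k).1 ∧ 0 ≤ (dihedralCoeff (A s t) (A t s) k).2) ∨
    ∃ m, m + 1 ≤ k ∧ ((alternatingWord s t (m + 1)).map (simple h)).prod =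
        ((alternatingWord t s (m + 1)).map (simple h)).prod := by
  by_cases h4 : 4 ≤ A s t * A t s
  · obtain ⟨hx, hy, -⟩ := dihedralCoeff_of_four_le hst hts h4 k
    exact Or.inl ⟨hx, hy⟩
  have hcases : (A s t = 0 ∧ A t s = 0) ∨ (A s t = -1 ∧ A t s = -1) ∨ (A s t = -1 ∧ A t s = -2) ∨
      (A s t = -2 ∧ A t s = -1) ∨ (A s t = -1 ∧ A t s = -3) ∨ (A s t = -3 ∧ A t s = -1) := by
    by_cases hz : A s t = 0
    · exact Or.inl ⟨hz, h0.1 hz⟩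
    have hz' : A t s ≠ 0 := fun e => hz (h0.2 e)
    have h1 : A s t ≤ -1 := by omega
    have h2 : A t s ≤ -1 := by omega
    have h3 : -3 ≤ A s t := by nlinarith
    have h5 : -3 ≤ A t s := by nlinarith
    clear h0 hz hz' hst hts
    generalize A s t = p at *
    generalize A t s = q at *
    interval_cases p <;> interval_cases q <;> omega
  rcases hcases with ⟨p, q⟩ | ⟨p, q⟩ | ⟨p, q⟩ | ⟨p, q⟩ | ⟨p, q⟩ | ⟨p, q⟩
  · by_cases hk : 2 ≤ k
    · exact Or.inr ⟨1, hk, alternatingWord_braid h s t (by simp [p, q])⟩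
    · left; rw [p, q]; interval_cases k <;> decide
  · by_cases hk : 3 ≤ k
    · exact Or.inr ⟨2, hk, alternatingWord_braid h s t (by simp [p, q])⟩
    · left; rw [p, q]; interval_cases k <;> decide
  · by_cases hk : 4 ≤ k
    · exact Or.inr ⟨3, hk, alternatingWord_braid h s t (by simp [p, q])⟩
    · left; rw [p, q]; interval_cases k <;> decide
  · by_cases hk : 4 ≤ k
    · exact Or.inr ⟨3, hk, alternatingWord_braid h s t (by simp [p, q])⟩
    · left; rw [p, q]; interval_cases k <;> decide
  · by_cases hk : 6 ≤ k
    · exact Or.inr ⟨5, hk, alternatingWord_braid h s t (by simp [p, q])⟩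
    · left; rw [p, q]; interval_cases k <;> decide
  · by_cases hk : 6 ≤ k
    · exact Or.inr ⟨5, hk, alternatingWord_braid h s t (by simp [p, q])⟩
    · left; rw [p, q]; interval_cases k <;> decide

/-! ### Positive and negative roots -/

theorem IsIndecomposableSymmetrizable.eq_zero_iff (hA : IsIndecomposableSymmetrizable A)
    (i j : Fin n) : A i j = 0 ↔ A j i = 0 := by
  obtain ⟨d, hd, hs⟩ := hA.symmetrizable
  have h1 := hs i j
  constructor <;> intro e <;> rw [e] at h1
  · simpa [(hd j).ne'] using h1.symm
  · simpa [(hd i).ne'] using h1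

/-- If right multiplication by `σ_s` does not shorten `w`, then the root `w e_s` is nonnegative. -/
theorem apply_single_nonneg (hA : IsIndecomposableSymmetrizable A) (w : weylGroup hA.diag)
    (s : Fin n) (hw : length hA.diag w ≤ length hA.diag (w * simple hA.diag s)) :
    0 ≤ w.1 (Pi.single s 1) := by
  induction hl : length hA.diag w using Nat.strong_induction_on generalizing w s with
  | _ l ih =>
    obtain ⟨ω, hω, rfl⟩ := exists_reduced_word hA.diag w
    rcases List.eq_nil_or_concat ω with rfl | ⟨η, t, rfl⟩
    · simp
    rw [List.concat_eq_append] at *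
    set w := ((η ++ [t]).map (simple hA.diag)).prod with hwdef
    have hwt : length hA.diag (w * simple hA.diag t) < length hA.diag w := by
      rw [← hω, hwdef, List.map_append, List.prod_append]
      simp only [List.map_cons, List.map_nil, List.prod_cons, List.prod_nil, mul_one,
        mul_simple_mul_simple, List.length_append, List.length_singleton]
      exact Nat.lt_succ_of_le (length_prod_le _ _)
    have hst : s ≠ t := by rintro rfl; omega
    obtain ⟨v, k, e, hk, hvs, hvt⟩ := exists_eq_mul_alternatingWord hA.diag w s t hw
    have hk0 : k ≠ 0 := by
      rintro rfl
      have hv : w = v := by simpa [alternatingWord] using e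
      rw [hv] at hwt
      omega
    have hs := ih _ (by omega) v s hvs rfl
    have ht := ih _ (by omega) v t hvt rfl
    rcases dihedralCoeff_nonneg_or_braid hA.diag s t (hA.nonpos s t hst)
      (hA.nonpos t s hst.symm) (hA.eq_zero_iff s t) k with ⟨hx, hy⟩ | ⟨m, hm, hb⟩
    · rw [e, mul_val_apply, alternatingWord_apply, map_add, map_smul, map_smul]
      exact add_nonneg (smul_nonneg hx hs) (smul_nonneg hy ht)
    · -- A braid move puts `s` at the end of a reduced word of `w`, against the choice of `s`.
      exfalso
      obtain ⟨j, rfl⟩ := Nat.exists_eq_add_of_le hm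
      obtain ⟨θ, hθ, hc⟩ := exists_alternatingWord_add s t (m + 1) j
      have hws : w * simple hA.diag s =
          v * ((θ ++ alternatingWord s t m).map (simple hA.diag)).prod := by
        rw [e, hc, List.map_append, List.prod_append, hb, alternatingWord_succ,
          List.concat_eq_append]
        simp only [List.map_append, List.prod_append, List.map_cons, List.map_nil,
          List.prod_cons, List.prod_nil, mul_one, ← mul_assoc, mul_simple_mul_simple]
      have := length_mul_prod_le hA.diag v (θ ++ alternatingWord s t m)
      rw [← hws, List.length_append, length_alternatingWord, hθ] at this
      omega

theorem apply_single_eq_neg (h : ∀ i, A i i = 2) (w : weylGroup h) (i : Fin n) :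
    (w * simple h i).1 (Pi.single i 1) = -w.1 (Pi.single i 1) := by
  rw [mul_val_apply, simple_val, reflection_single, h, ← map_neg]
  congr 1
  module

theorem apply_single_nonneg_or_nonpos (hA : IsIndecomposableSymmetrizable A)
    (w : weylGroup hA.diag) (i : Fin n) :
    0 ≤ w.1 (Pi.single i 1) ∨ w.1 (Pi.single i 1) ≤ 0 := by
  by_cases hw : length hA.diag w ≤ length hA.diag (w * simple hA.diag i)
  · exact Or.inl (apply_single_nonneg hA w i hw)
  · right
    have := apply_single_nonneg hA (w * simple hA.diag i) i
      (by rw [mul_simple_mul_simple]; omega)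
    rwa [apply_single_eq_neg, Left.nonneg_neg_iff] at this

theorem apply_single_ne_zero (h : ∀ i, A i i = 2) (w : weylGroup h) (i : Fin n) :
    w.1 (Pi.single i 1) ≠ 0 := by
  rw [Ne, LinearEquiv.map_eq_zero_iff]
  simp

theorem length_mul_simple_of_nonneg (hA : IsIndecomposableSymmetrizable A)
    (w : weylGroup hA.diag) (i : Fin n) (hw : 0 ≤ w.1 (Pi.single i 1)) :
    length hA.diag (w * simple hA.diag i) = length hA.diag w + 1 := by
  refine le_antisymm (length_mul_simple_le _ _ _) ?_
  by_contra hlt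
  have := apply_single_nonneg hA (w * simple hA.diag i) i
    (by rw [mul_simple_mul_simple]; omega)
  rw [apply_single_eq_neg, Left.nonneg_neg_iff] at this
  exact apply_single_ne_zero _ w i (le_antisymm this hw)

/-- The only positive root that a simple reflection makes negative is its own simple root. -/
theorem apply_single_eq_of_reflection_nonpos (h : ∀ i, A i i = 2) (u : weylGroup h) (i j : Fin n)
    (hu : 0 ≤ u.1 (Pi.single j 1)) (hs : reflection h i (u.1 (Pi.single j 1)) ≤ 0) :
    u.1 (Pi.single j 1) = Pi.single i 1 := by
  set x := u.1 (Pi.single j 1) with hx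
  have hxi : x = x i • Pi.single i 1 := by
    ext m
    by_cases hm : m = i
    · subst hm; simp
    · have h1 := hs m
      have h2 := hu m
      simp only [reflection_eq, Pi.sub_apply, Pi.smul_apply, Pi.single_eq_of_ne hm, smul_zero,
        sub_zero, Pi.zero_apply] at h1 h2 ⊢
      exact le_antisymm h1 h2
  -- The root `x` is the image of a basis vector, so its coefficient is a unit.
  have h1 : x i * u.1.symm (Pi.single i 1) j = 1 := by
    have : u.1.symm x = Pi.single j 1 := by simp [hx]
    rw [hxi, map_smul] at this
    simpa using congrFun this j
  have h2 : x i = 1 := Int.eq_one_of_mul_eq_one_right (hu i) h1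
  rw [hxi, h2, one_smul]

/-- The product of the simple reflections of the first `k` letters of the word `a`. -/
def prefixProd (h : ∀ i, A i i = 2) (a : ℕ → Fin n) (k : ℕ) : weylGroup h :=
  ((List.range k).map fun j => simple h (a j)).prod

theorem prefixProd_succ (h : ∀ i, A i i = 2) (a : ℕ → Fin n) (k : ℕ) :
    prefixProd h a (k + 1) = prefixProd h a k * simple h (a k) := by
  simp [prefixProd, List.range_succ]

theorem length_prefixProd (hA : IsIndecomposableSymmetrizable A) (a : ℕ → Fin n)
    (ha : ∀ k, 0 ≤ (prefixProd hA.diag a k).1 (Pi.single (a k) 1)) (k : ℕ) :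
    length hA.diag (prefixProd hA.diag a k) = k := by
  induction k with
  | zero => simpa [prefixProd] using length_prod_le hA.diag []
  | succ k ih => rw [prefixProd_succ, length_mul_simple_of_nonneg hA _ _ (ha k), ih]

/-- If the prefix of length `k` of a word makes a positive root negative, then it does so at some
letter `l`, where the root has become simple. -/
theorem exists_prefixProd_apply_eq_neg (hA : IsIndecomposableSymmetrizable A) (a : ℕ → Fin n)
    (k : ℕ) (u : weylGroup hA.diag) (j : Fin n) (hu : 0 ≤ u.1 (Pi.single j 1))
    (hk : (prefixProd hA.diag a k * u).1 (Pi.single j 1) ≤ 0) :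
    ∃ l < k, (prefixProd hA.diag a k * u).1 (Pi.single j 1) =
      -(prefixProd hA.diag a l).1 (Pi.single (a l) 1) := by
  induction k generalizing u with
  | zero =>
    have : prefixProd hA.diag a 0 = 1 := by simp [prefixProd]
    rw [this, one_mul] at hk
    exact absurd (le_antisymm hk hu) (apply_single_ne_zero _ u j)
  | succ k ih =>
    have e : prefixProd hA.diag a (k + 1) * u =
        prefixProd hA.diag a k * (simple hA.diag (a k) * u) := by
      rw [prefixProd_succ, mul_assoc]
    rcases apply_single_nonneg_or_nonpos hA (simple hA.diag (a k) * u) j with hs | hs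
    · rw [e] at hk ⊢
      obtain ⟨l, hl, hl'⟩ := ih _ hs hk
      exact ⟨l, by omega, hl'⟩
    · refine ⟨k, by omega, ?_⟩
      have := apply_single_eq_of_reflection_nonpos hA.diag u (a k) j hu hs
      rw [mul_val_apply, this, prefixProd_succ, apply_single_eq_neg]

/-! ### The invariant form over the reals -/

/-- The symmetric matrix `(d i * A i j)` over the reals. -/
def symmMatrix (A : Matrix (Fin n) (Fin n) ℤ) (d : Fin n → ℤ) : Matrix (Fin n) (Fin n) ℝ :=
  of fun i j => (d i : ℝ) * (A i j : ℝ)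

/-- The real vector with the same coordinates as an element of the root lattice. -/
def castVec (x : Fin n → ℤ) : Fin n → ℝ := fun j => (x j : ℝ)

/-- The value at a real vector of the linear form with coefficients `A i j`. -/
def realCoroot (A : Matrix (Fin n) (Fin n) ℤ) (i : Fin n) (y : Fin n → ℝ) : ℝ :=
  ∑ j, (A i j : ℝ) * y j

/-- The simple reflection `σ_i`, acting on `ℝⁿ`. -/
def realReflection (A : Matrix (Fin n) (Fin n) ℤ) (i : Fin n) (y : Fin n → ℝ) : Fin n → ℝ :=
  y - realCoroot A i y • Pi.single i 1

theorem castVec_single (i : Fin n) : castVec (Pi.single i 1) = Pi.single i 1 := by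
  ext j
  by_cases hj : j = i
  · subst hj; simp [castVec]
  · simp [castVec, hj]

theorem castVec_reflection (h : ∀ i, A i i = 2) (i : Fin n) (x : Fin n → ℤ) :
    castVec (reflection h i x) = realReflection A i (castVec x) := by
  ext j
  have e : ((coroot A i x : ℤ) : ℝ) = realCoroot A i (castVec x) := by
    simp [coroot, realCoroot, castVec, mulVec, dotProduct]
  by_cases hj : j = i
  · subst hj; simp [castVec, realReflection, reflection_eq, ← e]
  · simp [castVec, realReflection, reflection_eq, hj]

theorem symmMatrix_mulVec (d : Fin n → ℤ) (y : Fin n → ℝ) (i : Fin n) :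
    (symmMatrix A d *ᵥ y) i = d i * realCoroot A i y := by
  simp [symmMatrix, mulVec, dotProduct, realCoroot, Finset.mul_sum, mul_assoc]

theorem symmMatrix_isSymm {d : Fin n → ℤ} (hd : ∀ i j, d i * A i j = d j * A j i) :
    (symmMatrix A d).IsSymm := by
  ext i j
  simp only [symmMatrix, transpose_apply, of_apply]
  exact_mod_cast hd j i

theorem symmMatrix_form_comm {d : Fin n → ℤ} (hd : ∀ i j, d i * A i j = d j * A j i)
    (x y : Fin n → ℝ) : x ⬝ᵥ symmMatrix A d *ᵥ y = y ⬝ᵥ symmMatrix A d *ᵥ x := by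
  rw [dotProduct_mulVec, ← mulVec_transpose, symmMatrix_isSymm hd, dotProduct_comm]

/-- A simple reflection is self-adjoint for the invariant form. -/
theorem form_realReflection {d : Fin n → ℤ} (hd : ∀ i j, d i * A i j = d j * A j i) (i : Fin n)
    (x y : Fin n → ℝ) : x ⬝ᵥ symmMatrix A d *ᵥ realReflection A i y =
      realReflection A i x ⬝ᵥ symmMatrix A d *ᵥ y := by
  have h1 : x ⬝ᵥ symmMatrix A d *ᵥ (Pi.single i (1 : ℝ)) = d i * realCoroot A i x := by
    rw [symmMatrix_form_comm hd, single_one_dotProduct, symmMatrix_mulVec]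
  rw [realReflection, realReflection, mulVec_sub, mulVec_smul, dotProduct_sub, dotProduct_smul,
    h1, sub_dotProduct, smul_dotProduct, single_one_dotProduct, symmMatrix_mulVec]
  simp only [smul_eq_mul]
  ring

theorem form_apply_apply {d : Fin n → ℤ} (hd : ∀ i j, d i * A i j = d j * A j i)
    (h : ∀ i, A i i = 2) (w : weylGroup h) (x : Fin n → ℤ) :
    castVec (w.1 x) ⬝ᵥ symmMatrix A d *ᵥ castVec (w.1 x) =
      castVec x ⬝ᵥ symmMatrix A d *ᵥ castVec x := by
  obtain ⟨ω, rfl⟩ := exists_word h w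
  induction ω with
  | nil => simp
  | cons i ω ih =>
    rw [List.map_cons, List.prod_cons, mul_val_apply, ← ih, simple_val]
    set z := (ω.map (simple h)).prod.1 x
    have hz : reflection h i (reflection h i z) = z :=
      Module.involutive_reflection ((coroot_single A i i).trans (h i)) z
    conv_lhs => rw [castVec_reflection h, ← form_realReflection hd, ← castVec_reflection h,
      ← castVec_reflection h, hz]

/-- Perron–Frobenius: if the off-diagonal entries of a real symmetric matrix are nonpositive, then
its least eigenvalue has a nonnegative eigenvector, since passing to absolute values does not
increase the quadratic form. -/
theorem exists_nonneg_eigenvector (hn : 0 < n) {Q : Matrix (Fin n) (Fin n) ℝ} (hQ : Q.IsSymm)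
    (hoff : ∀ i j, i ≠ j → Q i j ≤ 0) :
    ∃ (μ : ℝ) (x : Fin n → ℝ), 0 ≤ x ∧ x ≠ 0 ∧ Q *ᵥ x = μ • x ∧
      ∀ y : Fin n → ℝ, μ * (y ⬝ᵥ y) ≤ y ⬝ᵥ Q *ᵥ y := by
  let S : Set (Fin n → ℝ) := {y | y ⬝ᵥ y = 1}
  have hcont : Continuous fun y : Fin n → ℝ => y ⬝ᵥ y := by
    simp only [dotProduct]; fun_prop
  have hcontQ : Continuous fun y : Fin n → ℝ => y ⬝ᵥ Q *ᵥ y := by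
    simp only [dotProduct, mulVec]; fun_prop
  have hS : IsCompact S := by
    refine IsCompact.of_isClosed_subset (isCompact_Icc (a := (-1 : Fin n → ℝ)) (b := 1))
      (isClosed_eq hcont continuous_const) fun y hy => ?_
    have hi : ∀ i, y i * y i ≤ 1 := fun i => by
      rw [← show y ⬝ᵥ y = 1 from hy]
      exact Finset.single_le_sum (f := fun i => y i * y i) (fun j _ => mul_self_nonneg (y j))
        (Finset.mem_univ i)
    exact ⟨fun i => by simp only [Pi.neg_apply, Pi.one_apply]; nlinarith [hi i],
      fun i => by simp only [Pi.one_apply]; nlinarith [hi i]⟩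
  have hne : S.Nonempty := ⟨Pi.single ⟨0, hn⟩ 1, by simp [S]⟩
  obtain ⟨x, hxS, hmin⟩ := hS.exists_isMinOn hne hcontQ.continuousOn
  have hxS' : x ⬝ᵥ x = 1 := hxS
  set μ := x ⬝ᵥ Q *ᵥ x with hμ
  have hbound : ∀ y : Fin n → ℝ, μ * (y ⬝ᵥ y) ≤ y ⬝ᵥ Q *ᵥ y := by
    intro y
    by_cases hy : y = 0
    · simp [hy]
    have hpos : 0 < y ⬝ᵥ y :=
      lt_of_le_of_ne (Finset.sum_nonneg fun i _ => mul_self_nonneg (y i))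
        fun e => hy (dotProduct_self_eq_zero.1 e.symm)
    set r := Real.sqrt (y ⬝ᵥ y) with hr
    have hr2 : r * r = y ⬝ᵥ y := Real.mul_self_sqrt hpos.le
    have hr0 : 0 < r := Real.sqrt_pos.2 hpos
    have hmem : r⁻¹ • y ∈ S := by
      simp only [S, Set.mem_ofPred_eq, dotProduct_smul, smul_dotProduct, smul_eq_mul, ← hr2]
      field_simp
    have := hmin hmem
    simp only [Set.mem_ofPred_eq, mulVec_smul, dotProduct_smul, smul_dotProduct,
      smul_eq_mul] at this
    rw [← hμ] at this
    rw [← hr2]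
    calc μ * (r * r) ≤ (r⁻¹ * (r⁻¹ * (y ⬝ᵥ Q *ᵥ y))) * (r * r) :=
          mul_le_mul_of_nonneg_right this (mul_self_nonneg r)
      _ = y ⬝ᵥ Q *ᵥ y := by field_simp
  have habs : |x| ⬝ᵥ |x| = 1 := by
    rw [← hxS']; simp [dotProduct]
  refine ⟨μ, |x|, abs_nonneg x, fun e => by simp [e] at habs, ?_, hbound⟩
  have hle : |x| ⬝ᵥ Q *ᵥ |x| ≤ μ := by
    rw [hμ]
    simp only [dotProduct, mulVec, Finset.mul_sum]
    refine Finset.sum_le_sum fun i _ => Finset.sum_le_sum fun j _ => ?_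
    simp only [Pi.abs_apply]
    by_cases hij : i = j
    · subst hij
      exact le_of_eq (by linear_combination Q i i * abs_mul_abs_self (x i))
    · have h1 := le_abs_self (x i * x j)
      rw [abs_mul] at h1
      nlinarith [hoff i j hij]
  -- The form of `Q - μ` is positive semidefinite and vanishes at `|x|`.
  have hform : ∀ y : Fin n → ℝ, y ⬝ᵥ (Q - μ • (1 : Matrix (Fin n) (Fin n) ℝ)) *ᵥ y =
      y ⬝ᵥ Q *ᵥ y - μ * (y ⬝ᵥ y) := fun y => by
    simp [sub_mulVec, smul_mulVec, dotProduct_sub, dotProduct_smul]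
  have hpsd : (Q - μ • (1 : Matrix (Fin n) (Fin n) ℝ)).PosSemidef := by
    refine PosSemidef.of_dotProduct_mulVec_nonneg ?_ fun y => ?_
    · have : (Q - μ • (1 : Matrix (Fin n) (Fin n) ℝ))ᵀ = Q - μ • 1 := by
        simp [hQ.eq]
      simpa [IsHermitian, conjTranspose_eq_transpose_of_trivial] using this
    · rw [star_trivial, hform]
      linarith [hbound y]
  have h0 : star |x| ⬝ᵥ (Q - μ • (1 : Matrix (Fin n) (Fin n) ℝ)) *ᵥ |x| = 0 := by
    refine le_antisymm ?_ (hpsd.dotProduct_mulVec_nonneg _)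
    rw [star_trivial, hform, habs]
    linarith
  have := (hpsd.dotProduct_mulVec_zero_iff _).1 h0
  rw [sub_mulVec, smul_mulVec, one_mulVec] at this
  exact sub_eq_zero.1 this

/-- A group that preserves a positive definite form and a lattice is finite. -/
theorem finite_weylGroup_of_form_pos (hA : IsIndecomposableSymmetrizable A) {d : Fin n → ℤ}
    (hd : ∀ i j, d i * A i j = d j * A j i) {μ : ℝ} (hμ : 0 < μ)
    (hb : ∀ y : Fin n → ℝ, μ * (y ⬝ᵥ y) ≤ y ⬝ᵥ symmMatrix A d *ᵥ y) :
    Finite (weylGroup hA.diag) := by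
  have hfin : ∀ C : ℝ, {x : Fin n → ℤ |
      castVec x ⬝ᵥ symmMatrix A d *ᵥ castVec x = C}.Finite := by
    intro C
    refine (Set.finite_Icc (fun _ => -⌈C / μ⌉ : Fin n → ℤ) (fun _ => ⌈C / μ⌉)).subset
      fun x hx => ?_
    have hi : ∀ i, |x i| ≤ ⌈C / μ⌉ := fun i => by
      have h1 : castVec x i * castVec x i ≤ castVec x ⬝ᵥ castVec x :=
        Finset.single_le_sum (f := fun i => castVec x i * castVec x i)
          (fun j _ => mul_self_nonneg _) (Finset.mem_univ i)
      have h2 := hb (castVec x)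
      rw [show castVec x ⬝ᵥ symmMatrix A d *ᵥ castVec x = C from hx] at h2
      have h3 : castVec x ⬝ᵥ castVec x ≤ C / μ := by
        rw [le_div_iff₀ hμ]; linarith
      have h4 : ((x i * x i : ℤ) : ℝ) ≤ (⌈C / μ⌉ : ℤ) := by
        push_cast
        exact (h1.trans h3).trans (Int.le_ceil _)
      have h5 : x i * x i ≤ ⌈C / μ⌉ := by exact_mod_cast h4
      have h6 : |x i| ≤ x i * x i := by
        rcases eq_or_ne (x i) 0 with e | e
        · simp [e]
        · have := Int.one_le_abs e
          nlinarith [abs_mul_abs_self (x i)]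
      exact h6.trans h5
    exact ⟨fun i => (abs_le.1 (hi i)).1, fun i => (abs_le.1 (hi i)).2⟩
  let f : weylGroup hA.diag → Fin n → Fin n → ℤ := fun w j => w.1 (Pi.single j 1)
  have hf : Function.Injective f := by
    intro v w e
    apply Subtype.ext
    apply LinearEquiv.toLinearMap_injective
    exact LinearMap.pi_ext' fun j => LinearMap.ext_ring (congrFun e j)
  have hr : (Set.range f).Finite := by
    refine (Set.Finite.pi' fun j => hfin (castVec (Pi.single j 1) ⬝ᵥ
      symmMatrix A d *ᵥ castVec (Pi.single j 1))).subset ?_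
    rintro _ ⟨w, rfl⟩ j
    exact form_apply_apply hd hA.diag w (Pi.single j 1)
  have := hr.to_subtype
  exact Finite.of_injective_finite_range hf

/-- In an indecomposable matrix, two complementary nonempty sets of indices are linked by a
nonzero entry. -/
theorem IsIndecomposableSymmetrizable.exists_ne_zero (hA : IsIndecomposableSymmetrizable A)
    (P : Fin n → Prop) (h1 : ∃ i, P i) (h2 : ∃ i, ¬ P i) :
    ∃ i j, ¬ P i ∧ P j ∧ A i j ≠ 0 := by
  classical
  by_contra! hc
  obtain ⟨i, hi⟩ := h1
  obtain ⟨j, hj⟩ := h2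
  let e : Fin n ≃ Fin (Fintype.card {a // P a}) ⊕ Fin (Fintype.card {a // ¬ P a}) :=
    (Equiv.sumCompl P).symm.trans
      (Equiv.sumCongr (Fintype.equivFin _) (Fintype.equivFin _))
  refine hA.indecomposable ⟨_, _, e, (reindex e e A).toBlocks₁₁, (reindex e e A).toBlocks₂₂,
    Fintype.card_pos_iff.2 ⟨⟨i, hi⟩⟩, Fintype.card_pos_iff.2 ⟨⟨j, hj⟩⟩, ?_⟩
  rw [← fromBlocks_toBlocks (reindex e e A)]
  congr 1
  · ext a b
    simp only [e, toBlocks₁₂, reindex_apply, submatrix_apply, of_apply, Matrix.zero_apply]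
    rw [hA.eq_zero_iff]
    exact hc _ _ ((Fintype.equivFin {a // ¬ P a}).symm b).2
      ((Fintype.equivFin {a // P a}).symm a).2
  · ext a b
    simp only [e, toBlocks₂₁, reindex_apply, submatrix_apply, of_apply, Matrix.zero_apply]
    exact hc _ _ ((Fintype.equivFin {a // ¬ P a}).symm a).2
      ((Fintype.equivFin {a // P a}).symm b).2

/-- If the Weyl group is infinite, then there is a positive vector in the closed antidominant
cone. -/
theorem exists_pos_antidominant (hn : 0 < n) (hA : IsIndecomposableSymmetrizable A)
    (hW : Infinite (weylGroup hA.diag)) :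
    ∃ δ : Fin n → ℝ, (∀ i, 0 < δ i) ∧ ∀ i, realCoroot A i δ ≤ 0 := by
  obtain ⟨d, hd0, hd⟩ := hA.symmetrizable
  have hd0' : ∀ i, (0 : ℝ) < d i := fun i => by exact_mod_cast hd0 i
  obtain ⟨μ, x, hx0, hxne, hx, hb⟩ := exists_nonneg_eigenvector hn (symmMatrix_isSymm hd)
    (fun i j hij => mul_nonpos_of_nonneg_of_nonpos (hd0' i).le
      (by exact_mod_cast hA.nonpos i j hij))
  have hμ : μ ≤ 0 := by
    by_contra! hμ
    exact not_finite_iff_infinite.2 hW (finite_weylGroup_of_form_pos hA hd hμ hb)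
  have hxi : ∀ i, d i * realCoroot A i x = μ * x i := fun i => by
    rw [← symmMatrix_mulVec, hx]; rfl
  refine ⟨x, fun i => ?_, fun i => ?_⟩
  · by_contra hi
    obtain ⟨j, hj⟩ : ∃ j, 0 < x j := by
      by_contra! hc
      exact hxne (le_antisymm hc hx0)
    obtain ⟨a, b, ha, hb, hab⟩ := hA.exists_ne_zero (fun j => 0 < x j) ⟨j, hj⟩ ⟨i, hi⟩
    have hxa : x a = 0 := le_antisymm (not_lt.1 ha) (hx0 a)
    have hz : realCoroot A a x = 0 := by
      have := hxi a
      rw [hxa, mul_zero] at this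
      exact (mul_eq_zero.1 this).resolve_left (hd0' a).ne'
    -- All terms of the vanishing sum `∑ j, A a j * x j` are nonpositive.
    have hterm : ∀ j ∈ Finset.univ, (A a j : ℝ) * x j ≤ 0 := fun j _ => by
      by_cases haj : a = j
      · rw [← haj, hxa, mul_zero]
      · exact mul_nonpos_of_nonpos_of_nonneg (by exact_mod_cast hA.nonpos a j haj) (hx0 j)
    have := (Finset.sum_eq_zero_iff_of_nonpos hterm).1 hz b (Finset.mem_univ b)
    rcases mul_eq_zero.1 this with h0 | h0
    · exact hab (by exact_mod_cast h0)
    · exact hb.ne' h0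
  · have h1 : d i * realCoroot A i x ≤ 0 := by
      rw [hxi]; exact mul_nonpos_of_nonpos_of_nonneg hμ (hx0 i)
    exact nonpos_of_mul_nonpos_right h1 (hd0' i)

/-! ### The Euler form -/

/-- The Euler form of an ordering `L` of the indices, a bilinear form whose symmetrization is the
invariant form: its value at `(e_a, e_b)` is `d a` if `a = b`, is `d a * A a b` if `b` stands before
`a` in `L`, and is `0` otherwise. -/
def eulerForm (A : Matrix (Fin n) (Fin n) ℤ) (d : Fin n → ℤ) :
    List (Fin n) → (Fin n → ℝ) → (Fin n → ℝ) → ℝ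
  | [], _, _ => 0
  | i :: L, x, y =>
    d i * y i * (x i + (L.map fun a => (A i a : ℝ) * x a).sum) + eulerForm A d L x y

theorem eulerForm_append_singleton {d : Fin n → ℤ} (hd : ∀ i j, d i * A i j = d j * A j i)
    (L : List (Fin n)) (i : Fin n) (x y : Fin n → ℝ) :
    eulerForm A d (L ++ [i]) x y =
      eulerForm A d L x y + d i * x i * (y i + (L.map fun a => (A i a : ℝ) * y a).sum) := by
  induction L with
  | nil => simp [eulerForm]; ring
  | cons j L ih =>
    have hij : (d i : ℝ) * A i j = d j * A j i := by exact_mod_cast hd i j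
    simp only [List.cons_append, eulerForm, ih, List.map_append, List.sum_append, List.map_cons,
      List.map_nil, List.sum_cons, List.sum_nil]
    linear_combination -(x i * y j) * hij

theorem eulerForm_congr (d : Fin n → ℤ) (L : List (Fin n)) {x x' y y' : Fin n → ℝ}
    (hx : ∀ a ∈ L, x a = x' a) (hy : ∀ a ∈ L, y a = y' a) :
    eulerForm A d L x y = eulerForm A d L x' y' := by
  induction L with
  | nil => rfl
  | cons i L ih =>
    have hmap : (L.map fun a => (A i a : ℝ) * x a) = L.map fun a => (A i a : ℝ) * x' a :=
      List.map_congr_left fun a ha => by rw [hx a (List.mem_cons_of_mem _ ha)]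
    rw [eulerForm, eulerForm, hmap, hx i List.mem_cons_self, hy i List.mem_cons_self,
      ih (fun a ha => hx a (List.mem_cons_of_mem _ ha))
        (fun a ha => hy a (List.mem_cons_of_mem _ ha))]

theorem eulerForm_neg_left (d : Fin n → ℤ) (L : List (Fin n)) (x y : Fin n → ℝ) :
    eulerForm A d L (-x) y = -eulerForm A d L x y := by
  induction L with
  | nil => simp [eulerForm]
  | cons i L ih =>
    have : (L.map fun a => (A i a : ℝ) * (-x) a).sum =
        -(L.map fun a => (A i a : ℝ) * x a).sum := by
      simpa using List.sum_map_mul_left L (fun a => (A i a : ℝ) * x a) (-1)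
    rw [eulerForm, eulerForm, ih, this, Pi.neg_apply]
    ring

theorem eulerForm_zero_left (d : Fin n → ℤ) (L : List (Fin n)) (y : Fin n → ℝ) :
    eulerForm A d L 0 y = 0 := by
  have := eulerForm_neg_left (A := A) d L 0 y
  rw [neg_zero] at this
  linarith

/-- The simple root of the first index is "projective" for the Euler form. -/
theorem eulerForm_single_head (d : Fin n → ℤ) {i : Fin n} {L : List (Fin n)}
    (hL : (i :: L).Nodup) (y : Fin n → ℝ) :
    eulerForm A d (i :: L) (Pi.single i 1) y = d i * y i := by
  have hz : ∀ a ∈ L, (Pi.single i 1 : Fin n → ℝ) a = (0 : Fin n → ℝ) a := fun a ha =>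
    Pi.single_eq_of_ne (by rintro rfl; exact (List.nodup_cons.1 hL).1 ha) _
  have hmap : (L.map fun a => (A i a : ℝ) * (Pi.single i 1 : Fin n → ℝ) a).sum = 0 :=
    List.sum_eq_zero fun r hr => by
      obtain ⟨a, ha, rfl⟩ := List.mem_map.1 hr
      rw [hz a ha, Pi.zero_apply, mul_zero]
  rw [eulerForm, hmap, eulerForm_congr d L hz fun _ _ => rfl, eulerForm_zero_left]
  simp

theorem realCoroot_eq_add_sum (h : ∀ i, A i i = 2) {i : Fin n} {L : List (Fin n)}
    (hL : (i :: L).Nodup) (hall : ∀ j, j ∈ i :: L) (x : Fin n → ℝ) :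
    realCoroot A i x = 2 * x i + (L.map fun a => (A i a : ℝ) * x a).sum := by
  have hu : (Finset.univ : Finset (Fin n)) = (i :: L).toFinset := by
    ext j; simpa using hall j
  rw [realCoroot, hu, List.sum_toFinset _ hL, List.map_cons, List.sum_cons, h i]
  norm_num

/-- The simple reflection of the first index carries the Euler form of an ordering to that of the
ordering in which this index has been moved to the end. -/
theorem eulerForm_realReflection (h : ∀ i, A i i = 2) {d : Fin n → ℤ}
    (hd : ∀ i j, d i * A i j = d j * A j i) {i : Fin n} {L : List (Fin n)}
    (hL : (i :: L).Nodup) (hall : ∀ j, j ∈ i :: L) (x y : Fin n → ℝ) :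
    eulerForm A d (L ++ [i]) (realReflection A i x) (realReflection A i y) =
      eulerForm A d (i :: L) x y := by
  have hne : ∀ z : Fin n → ℝ, ∀ a ∈ L, realReflection A i z a = z a := fun z a ha => by
    have : a ≠ i := by rintro rfl; exact (List.nodup_cons.1 hL).1 ha
    simp [realReflection, this]
  have hi : ∀ z : Fin n → ℝ,
      realReflection A i z i = -z i - (L.map fun a => (A i a : ℝ) * z a).sum := fun z => by
    simp only [realReflection, Pi.sub_apply, Pi.smul_apply, Pi.single_eq_same, smul_eq_mul,
      realCoroot_eq_add_sum h hL hall]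
    ring
  have hmap : (L.map fun a => (A i a : ℝ) * realReflection A i y a) =
      L.map fun a => (A i a : ℝ) * y a :=
    List.map_congr_left fun a ha => by rw [hne y a ha]
  rw [eulerForm_append_singleton hd, eulerForm_congr d L (hne x) (hne y), hmap, hi, hi, eulerForm]
  ring

theorem realReflection_realReflection (h : ∀ i, A i i = 2) (i : Fin n) (x : Fin n → ℝ) :
    realReflection A i (realReflection A i x) = x := by
  have h1 : realCoroot A i (realReflection A i x) = -realCoroot A i x := by
    simp only [realCoroot, realReflection, Pi.sub_apply, Pi.smul_apply, smul_eq_mul, mul_sub,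
      Finset.sum_sub_distrib]
    rw [Finset.sum_eq_single (a := i) (s := Finset.univ)
      (f := fun j => (A i j : ℝ) * ((∑ j, (A i j : ℝ) * x j) * (Pi.single i 1 : Fin n → ℝ) j))
      (fun j _ hj => by simp [hj]) (by simp)]
    simp only [Pi.single_eq_same, h i]
    push_cast
    ring
  rw [realReflection, h1, realReflection]
  module

/-! ### Powers of a Coxeter element -/

/-- The images of `y` under the simple reflections of the first letters of the word `a`, applied
one after the other. -/
def reflectionOrbit (A : Matrix (Fin n) (Fin n) ℤ) (a : ℕ → Fin n) (y : Fin n → ℝ) :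
    ℕ → Fin n → ℝ
  | 0 => y
  | k + 1 => realReflection A (a k) (reflectionOrbit A a y k)

theorem form_reflectionOrbit (h : ∀ i, A i i = 2) {d : Fin n → ℤ}
    (hd : ∀ i j, d i * A i j = d j * A j i) (a : ℕ → Fin n) (y : Fin n → ℝ) (k : ℕ)
    (x : Fin n → ℤ) :
    castVec x ⬝ᵥ symmMatrix A d *ᵥ reflectionOrbit A a y k =
      castVec ((prefixProd h a k).1 x) ⬝ᵥ symmMatrix A d *ᵥ y := by
  induction k generalizing x with
  | zero => simp [prefixProd, reflectionOrbit]
  | succ k ih =>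
    rw [reflectionOrbit, form_realReflection hd, ← castVec_reflection h, ih, prefixProd_succ]
    rfl

theorem eulerForm_reflectionOrbit (h : ∀ i, A i i = 2) {d : Fin n → ℤ}
    (hd : ∀ i j, d i * A i j = d j * A j i) (a : ℕ → Fin n) (M : ℕ → List (Fin n))
    (hnd : ∀ k, (a k :: M k).Nodup) (hall : ∀ k j, j ∈ a k :: M k)
    (hM : ∀ k, a (k + 1) :: M (k + 1) = M k ++ [a k]) (y : Fin n → ℝ) (k : ℕ) (x : Fin n → ℤ) :
    eulerForm A d (a k :: M k) (castVec x) (reflectionOrbit A a y k) =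
      eulerForm A d (a 0 :: M 0) (castVec ((prefixProd h a k).1 x)) y := by
  induction k generalizing x with
  | zero => simp [prefixProd, reflectionOrbit]
  | succ k ih =>
    rw [hM, reflectionOrbit, ← realReflection_realReflection h (a k) (castVec x),
      eulerForm_realReflection h hd (hnd k) (hall k), ← castVec_reflection h, ih, prefixProd_succ]
    rfl

/-- The heart of the argument: the Euler form with a positive antidominant vector `δ` is positive
on the roots of the word, as long as the word is reduced, which excludes that a new root is the
negative of an earlier one. -/
theorem prefixProd_apply_single_nonneg (hA : IsIndecomposableSymmetrizable A) {δ : Fin n → ℝ}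
    (hδ : ∀ i, 0 < δ i) (hδA : ∀ i, realCoroot A i δ ≤ 0) (a : ℕ → Fin n)
    (M : ℕ → List (Fin n)) (hnd : ∀ k, (a k :: M k).Nodup) (hall : ∀ k j, j ∈ a k :: M k)
    (hM : ∀ k, a (k + 1) :: M (k + 1) = M k ++ [a k]) (k : ℕ) :
    0 ≤ (prefixProd hA.diag a k).1 (Pi.single (a k) 1) := by
  obtain ⟨d, hd0, hd⟩ := hA.symmetrizable
  have hd0' : ∀ i, (0 : ℝ) < d i := fun i => by exact_mod_cast hd0 i
  induction k using Nat.strong_induction_on with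
  | _ k ih =>
    -- Each step adds a nonnegative multiple of a simple root to the image of `δ`.
    have hle : ∀ l ≤ k, δ ≤ reflectionOrbit A a δ l := by
      intro l hl
      induction l with
      | zero => exact le_rfl
      | succ l ihl =>
        refine (ihl (by omega)).trans ?_
        have h1 := form_reflectionOrbit hA.diag hd a δ l (Pi.single (a l) 1)
        rw [castVec_single, single_one_dotProduct, symmMatrix_mulVec] at h1
        have h2 : castVec ((prefixProd hA.diag a l).1 (Pi.single (a l) 1)) ⬝ᵥ
            symmMatrix A d *ᵥ δ ≤ 0 := by
          refine Finset.sum_nonpos fun i _ => mul_nonpos_of_nonneg_of_nonpos ?_ ?_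
          · exact Int.cast_nonneg (ih l (by omega) i)
          · rw [symmMatrix_mulVec]
            exact mul_nonpos_of_nonneg_of_nonpos (hd0' i).le (hδA i)
        rw [← h1] at h2
        have h3 := nonpos_of_mul_nonpos_right h2 (hd0' (a l))
        intro j
        by_cases hj : j = a l
        · subst hj; simp [reflectionOrbit, realReflection, h3]
        · simp [reflectionOrbit, realReflection, hj]
    have hpos : ∀ l ≤ k, 0 < eulerForm A d (a 0 :: M 0)
        (castVec ((prefixProd hA.diag a l).1 (Pi.single (a l) 1))) δ := by
      intro l hl
      rw [← eulerForm_reflectionOrbit hA.diag hd a M hnd hall hM, castVec_single,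
        eulerForm_single_head d (hnd l)]
      exact mul_pos (hd0' _) ((hδ _).trans_le (hle l hl _))
    refine (apply_single_nonneg_or_nonpos hA _ _).resolve_right fun hneg => ?_
    obtain ⟨l, hl, e⟩ := exists_prefixProd_apply_eq_neg hA a k 1 (a k)
      (by simp) (by rwa [mul_one])
    rw [mul_one] at e
    have h1 := hpos k le_rfl
    have hc : ∀ x : Fin n → ℤ, castVec (-x) = -castVec x := fun x => by
      ext j; simp [castVec]
    rw [e, hc, eulerForm_neg_left] at h1
    linarith [hpos l hl.le]

/-- A complete ordering `L` of the indices, repeated `m` times, is a reduced word. -/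
theorem length_prod_pow (hn : 0 < n) (hA : IsIndecomposableSymmetrizable A)
    (hW : Infinite (weylGroup hA.diag)) (L : List (Fin n)) (hL : L.Nodup) (hall : ∀ j, j ∈ L)
    (m : ℕ) : length hA.diag ((L.map (simple hA.diag)).prod ^ m) = m * n := by
  obtain ⟨δ, hδ, hδA⟩ := exists_pos_antidominant hn hA hW
  have hlen : L.length = n := by
    have : L.toFinset = Finset.univ := Finset.eq_univ_iff_forall.2 fun j => by simpa using hall j
    rw [← List.toFinset_card_of_nodup hL, this, Finset.card_fin]
  have hlt : ∀ k, k % n < L.length := fun k => by rw [hlen]; exact Nat.mod_lt _ hn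
  let a : ℕ → Fin n := fun k => L[k % n]'(hlt k)
  let M : ℕ → List (Fin n) := fun k => (L.rotate k).tail
  have hrot : ∀ k, L.rotate k = a k :: M k := by
    intro k
    have hne : L.rotate k ≠ [] := by
      rw [Ne, List.rotate_eq_nil_iff]; rintro rfl; simp at hlen; omega
    rw [← List.cons_head_tail hne]
    congr 1
    rw [List.head_eq_getElem, List.getElem_rotate]
    simp [a, hlen]
  have hreduced := length_prefixProd hA a (prefixProd_apply_single_nonneg hA hδ hδA a M
    (fun k => by rw [← hrot]; exact List.nodup_rotate.2 hL)
    (fun k j => by rw [← hrot]; exact List.mem_rotate.2 (hall j))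
    (fun k => by rw [← hrot, ← List.rotate_rotate, hrot]; simp))
  have hblock : ∀ m, (List.range n).map (fun j => a (m * n + j)) = L := by
    intro m
    refine List.ext_getElem (by simp [hlen]) fun j h1 h2 => ?_
    simp [a, Nat.mod_eq_of_lt (hlen ▸ h2)]
  have hpow : ∀ m, prefixProd hA.diag a (m * n) = (L.map (simple hA.diag)).prod ^ m := by
    intro m
    induction m with
    | zero => simp [prefixProd]
    | succ m ih =>
      rw [pow_succ, ← ih, Nat.succ_mul, prefixProd, prefixProd, List.range_add, List.map_append,
        List.prod_append]
      conv_rhs => rw [← hblock m]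
      simp [List.map_map, Function.comp_def]
  rw [← hpow, hreduced]

end GenCartan

end

theorem mainTheorem1 {n : ℕ} (hn : 0 < n) (A : Matrix (Fin n) (Fin n) ℤ)
    (hA : GenCartan.IsIndecomposableSymmetrizable A) (v : Equiv.Perm (Fin n)) :
    Infinite (GenCartan.weylGroup hA.diag) ↔
      ∀ m : ℤ, GenCartan.length hA.diag (GenCartan.coxeterElement hA.diag v ^ m) =
        m.natAbs * n := by
  constructor
  · intro hW m
    have hc : GenCartan.coxeterElement hA.diag v =
        ((List.ofFn v).reverse.map (GenCartan.simple hA.diag)).prod := by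
      rw [GenCartan.coxeterElement, List.map_reverse, List.map_ofFn]
      rfl
    have hpow := GenCartan.length_prod_pow hn hA hW (List.ofFn v).reverse
      (by simpa [List.nodup_ofFn] using v.injective)
      (fun j => by simpa [List.mem_ofFn] using v.surjective j)
    rw [← hc] at hpow
    obtain ⟨k, rfl | rfl⟩ := m.eq_nat_or_neg
    · simpa using hpow k
    · simpa [GenCartan.length_inv] using hpow k
  · intro hlen
    refine Infinite.of_injective
      (fun m : ℕ => GenCartan.coxeterElement hA.diag v ^ (m : ℤ)) fun a b e => ?_
    have := congrArg (GenCartan.length hA.diag) e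
    simp only [hlen, Int.natAbs_natCast] at this
    exact Nat.eq_of_mul_eq_mul_right hn this
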